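/- **Notation.** For a finite set $I$ with $N$ elements let $W(\mathsf B_N)$ be the group of signed permutations of the pairs of symbols $j^{+},j^{-}$ ($j\in I$), where $c_j$ exchanges $j^+$ and $j^-$ and a permutation $\tau$ of $I$ sends $j^\pm$ to $\tau(j)^\pm$; let $W(\mathsf D_N)$ be the subgroup of all $c_{j_1}\cdots c_{j_t}\tau$ (with $j_1,\dots,j_t$ distinct) with $t$ even. Let $\mathrm{Pic}=\mathbb Z l_{-1}\oplus\mathbb Z l_0\oplus\bigoplus_{j\in I}\mathbb Z l_j$ and $K=-2(l_{-1}+l_0)+\sum_{j} l_j$. The element $g=c_{j_1}\cdots c_{j_t}\tau\in W(\mathsf D_N)$ acts on $\mathrm{Pic}$ by $l_0\mapsto l_0$; $l_j\mapsto l_{\tau(j)}$ if $\tau(j)\notin\{j_1,\dots,j_t\}$ and $l_j\mapsto l_0-l_{\tau(j)}$ otherwise; $l_{-1}\mapsto l_{-1}+\tfrac t2 l_0-\sum_{i=1}^t l_{j_i}$. A subgroup $G\subseteq W(\mathsf D_N)$ satisfies (H1) if $\mathrm H^1(H,\mathrm{Pic})=0$ for every subgroup $H\subseteq G$, and it is relatively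 minimal if $\mathrm{Pic}^G=\mathbb Z l_0\oplus\mathbb Z K$. For $n\ge 1$ let $\mathfrak D_{2n+1}\subset W(\mathsf D_{2n+2})$, with $I=\{1,\dots,2n+2\}$, be generated by $$g_1=c_1c_2\cdots c_{2n+2}(2,3)(4,5)\cdots(2n,2n+1),\qquad g_2=(1,2,4,\dots,2n,2n+1,2n-1,\dots,3).$$ For an odd prime $p$ and $r\ge1$ write $\mathbb F_{p^r}=(\mathbb Z/p)[x]/(h)$ with $h$ monic irreducible of degree $r$, let $\Gamma$ be a generator of $\mathbb F_{p^r}^*$, and label the class of $a_0+a_1x+\dots+a_{r-1}x^{r-1}$ ($0\le a_i<p$) by $a_0+a_1p+\dots+a_{r-1}p^{r-1}$, except that the class $0$ has label $p^r$. Let $\mathfrak F_{p^r}\subset W(\mathsf D_{p^r+1})$, with $I=\{1,\dots,p^r+1\}$, be generated by $$g_1=c_1\cdots c_{p^r+1}\,(1,\mathrm{lab}(\Gamma),\dots,\mathrm{lab}(\Gamma^{p^r-2})),$$ $$g_2=(p^r,1,\dots,p-1)(p,p+1,\dots,2p-1)\cdots(p^r-p,\dots,p^r-1).$$ In each of these groups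 the last index is an orbit of length one of the action on $I$. Given two such groups $G\subset W(\mathsf D_{m+1})$ and $G'\subset W(\mathsf D_{m'+1})$, take the disjoint union of the two index sets with the two last indices identified, and let $G$ and $G'$ act on the $m+m'+1$ resulting pairs, each acting trivially on the pairs coming only from the other one. **Theorem.** For all integers $n,n_1,n_2,r\ge1$, all odd primes $p$, and all choices of $h$ and $\Gamma$, let $(G,G')$ be $(\mathfrak D_{2n_1+1},\mathfrak D_{2n_2+1})$ or $(\mathfrak D_{2n+1},\mathfrak F_{p^r})$. Then the subgroup generated by $G$ and $G'$ is the direct product $G\times G'$ (that is, $(g,g')\mapsto gg'$ is an isomorphism from $G\times G'$ onto it), it is contained in $W(\mathsf D_{m+m'+1})$, and it satisfies (H1) and is relatively minimal. -/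

import Mathlib

open Equiv

noncomputable section

namespace ConicBundle

/-! ### Signed permutations -/

/-- The group `W(B_ι)` of signed permutations of the finite index set `ι`, the automorphism group
of the pairs of symbols `j⁺, j⁻` with `j ∈ ι`. The element `⟨s, τ⟩` is `c_{j₁} ⋯ c_{jₜ} τ`, where
`j₁, …, jₜ` are the indices at which `s` is `-1`: it sends `j^±` to `(τ j)^{± s (τ j)}`.
The product is the one with `τ c_j = c_{τ(j)} τ`. -/
abbrev WB (ι : Type) : Type := (ι → ℤˣ) ⋊[mulAutArrow] Perm ι

/-- The character `σ(c_{j₁} ⋯ c_{jₜ} τ) = (-1)ᵗ`. -/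
def signChar (ι : Type) [Fintype ι] : WB ι →* ℤˣ where
  toFun g := ∏ i, g.left i
  map_one' := by simp
  map_mul' g h := by
    simp only [SemidirectProduct.mul_left, Pi.mul_apply, Finset.prod_mul_distrib]
    congr 1
    exact Equiv.prod_comp (g.right⁻¹ : Perm ι) h.left

/-- The Weyl group `W(D_ι)`: signed permutations with an even number of minus signs. -/
def WD (ι : Type) [Fintype ι] : Subgroup (WB ι) := (signChar ι).ker

/-- `neg g i` is `1` if the sign of `g` at `i` is `-1`, and `0` otherwise. -/
def neg {ι : Type} (g : WB ι) (i : ι) : ℤ := if g.left i = -1 then 1 else 0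

/-- The number `t` of minus signs of `c_{j₁} ⋯ c_{jₜ} τ`. -/
def numNeg {ι : Type} [Fintype ι] (g : WB ι) : ℤ := ∑ i, neg g i

lemma left_eq {ι : Type} (g : WB ι) (i : ι) : ((g.left i : ℤˣ) : ℤ) = 1 - 2 * neg g i := by
  unfold neg
  rcases Int.units_eq_one_or (g.left i) with h | h <;> simp [h]

lemma neg_mul {ι : Type} (g h : WB ι) (i : ι) :
    neg (g * h) i =
      neg g i * ((h.left (g.right⁻¹ i) : ℤˣ) : ℤ) + neg h (g.right⁻¹ i) := by
  have h1 : (((g * h).left i : ℤˣ) : ℤ)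
      = ((g.left i : ℤˣ) : ℤ) * ((h.left (g.right⁻¹ i) : ℤˣ) : ℤ) := by
    rw [← Units.val_mul]; rfl
  have h2 := left_eq (g * h) i
  have h3 := left_eq g i
  have h4 := left_eq h (g.right⁻¹ i)
  rw [h1, h3, h4] at h2
  rw [h4]
  linarith

lemma numNeg_even {ι : Type} [Fintype ι] {g : WB ι} (hg : g ∈ WD ι) : 2 ∣ numNeg g := by
  have h1 : ∏ i, g.left i = 1 := hg
  have h2 : ∀ i, g.left i = if g.left i = -1 then -1 else 1 := by
    intro i
    rcases Int.units_eq_one_or (g.left i) with h | h <;> simp [h]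
  rw [Finset.prod_congr rfl (fun i _ => h2 i), Finset.prod_ite] at h1
  simp only [Finset.prod_const, mul_one, one_pow] at h1
  have h3 := (neg_one_pow_eq_one_iff_even (R := ℤˣ) (by decide)).1 h1
  have h4 : numNeg g = ((Finset.univ.filter fun i => g.left i = -1).card : ℤ) := by
    simp [numNeg, neg]
  rw [h4]
  exact_mod_cast h3.two_dvd

/-! ### The Picard lattice with its action of `W(D_ι)` -/

/-- The geometric Picard lattice of a conic bundle whose degenerate fibres are indexed by `ι`.
`(a, b, x)` stands for `a l₋₁ + b l₀ + ∑ᵢ xᵢ lᵢ`; `l₀` is the class of a fibre, and `lᵢ` and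
`l₀ - lᵢ` are the two components of the degenerate fibre with index `i`. -/
abbrev Pic (ι : Type) : Type := ℤ × ℤ × (ι → ℤ)

/-- The class `l₀` of a fibre. -/
def fiberClass (ι : Type) : Pic ι := (0, 1, 0)

/-- The canonical class `K = -2 (l₋₁ + l₀) + ∑ᵢ lᵢ`. -/
def canonicalClass (ι : Type) : Pic ι := (-2, -2, fun _ => 1)

/-- The linear map given by a signed permutation `g = c_{j₁} ⋯ c_{jₜ} τ`, `t` even:
* `l₀ ↦ l₀`;
* `lⱼ ↦ l_{τ j}` if the sign of `g` at `τ j` is `1`, and `lⱼ ↦ l₀ - l_{τ j}` if it is `-1`;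
* `l₋₁ ↦ l₋₁ + (t / 2) l₀ - (l_{j₁} + ⋯ + l_{jₜ})`. -/
def picMap {ι : Type} [Fintype ι] (g : WB ι) : Pic ι →ₗ[ℤ] Pic ι where
  toFun v := (v.1,
    v.2.1 + v.1 * (numNeg g / 2) + ∑ i, neg g i * v.2.2 (g.right⁻¹ i),
    fun i => ((g.left i : ℤˣ) : ℤ) * v.2.2 (g.right⁻¹ i) - v.1 * neg g i)
  map_add' v w := by
    refine Prod.ext rfl (Prod.ext ?_ (funext fun i => ?_))
    · simp only [Prod.fst_add, Prod.snd_add, Pi.add_apply, mul_add, Finset.sum_add_distrib]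
      ring
    · simp only [Prod.fst_add, Prod.snd_add, Pi.add_apply]
      ring
  map_smul' c v := by
    refine Prod.ext rfl (Prod.ext ?_ (funext fun i => ?_))
    · simp only [Prod.smul_fst, Prod.smul_snd, Pi.smul_apply, smul_eq_mul, RingHom.id_apply,
        mul_add, Finset.mul_sum, mul_assoc]
      congr 1
      exact Finset.sum_congr rfl fun i _ => by ring
    · simp only [Prod.smul_fst, Prod.smul_snd, Pi.smul_apply, smul_eq_mul, RingHom.id_apply]
      ring

/-- The integral representation of `W(D_ι)` on the Picard lattice. -/
def picRep (ι : Type) [Fintype ι] : Representation ℤ (WD ι) (Pic ι) where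
  toFun g := picMap (g : WB ι)
  map_one' := by
    refine LinearMap.ext fun v => Prod.ext rfl (Prod.ext ?_ (funext fun i => ?_)) <;>
      simp [picMap, numNeg, neg]
  map_mul' g h := by
    obtain ⟨g, hg⟩ := g
    obtain ⟨h, hh⟩ := h
    have hgh : g * h ∈ WD ι := mul_mem hg hh
    obtain ⟨a, ha⟩ := numNeg_even hg
    obtain ⟨b, hb⟩ := numNeg_even hh
    obtain ⟨c, hc⟩ := numNeg_even hgh
    have hre : ∀ f : ι → ℤ, ∑ i, f (g.right⁻¹ i) = ∑ i, f i :=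
      fun f => Equiv.sum_comp (g.right⁻¹ : Perm ι) f
    have key : c = a + b - ∑ i, neg g i * neg h (g.right⁻¹ i) := by
      have e : numNeg (g * h)
          = numNeg g + numNeg h - 2 * ∑ i, neg g i * neg h (g.right⁻¹ i) := by
        simp only [numNeg, neg_mul, left_eq]
        rw [← hre (neg h), Finset.mul_sum, ← Finset.sum_add_distrib, ← Finset.sum_sub_distrib]
        exact Finset.sum_congr rfl fun i _ => by ring
      linarith
    refine LinearMap.ext fun v => Prod.ext rfl (Prod.ext ?_ (funext fun i => ?_))
    · have e1 : ∑ i, neg (g * h) i * v.2.2 ((g * h).right⁻¹ i)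
          = ∑ i, neg g i * (((h.left (g.right⁻¹ i) : ℤˣ) : ℤ) * v.2.2 (h.right⁻¹ (g.right⁻¹ i)))
            + ∑ i, neg h i * v.2.2 (h.right⁻¹ i) := by
        rw [← hre (fun i => neg h i * v.2.2 (h.right⁻¹ i)), ← Finset.sum_add_distrib]
        refine Finset.sum_congr rfl fun i _ => ?_
        rw [neg_mul, SemidirectProduct.mul_right, mul_inv_rev, Perm.mul_apply]
        ring
      simp only [picMap, Subgroup.coe_mul, Module.End.mul_apply, LinearMap.coe_mk, AddHom.coe_mk]
      rw [e1, hc, ha, hb]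
      simp only [mul_sub, Finset.sum_sub_distrib, Int.mul_ediv_cancel_left _ (two_ne_zero' ℤ)]
      have e2 : ∑ i, neg g i * (v.1 * neg h (g.right⁻¹ i))
          = v.1 * ∑ i, neg g i * neg h (g.right⁻¹ i) := by
        rw [Finset.mul_sum]
        exact Finset.sum_congr rfl fun i _ => by ring
      rw [e2, key]
      ring
    · have e0 : (((g * h).left i : ℤˣ) : ℤ)
          = ((g.left i : ℤˣ) : ℤ) * ((h.left (g.right⁻¹ i) : ℤˣ) : ℤ) := by
        rw [← Units.val_mul]; rfl
      simp only [picMap, Subgroup.coe_mul, Module.End.mul_apply, LinearMap.coe_mk, AddHom.coe_mk]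
      rw [e0, neg_mul, SemidirectProduct.mul_right, mul_inv_rev, Perm.mul_apply]
      simp only [left_eq]
      ring

/-! ### The two conditions -/

/-- Condition (H1): `H¹(H, Pic) = 0` for all subgroups `H` of `G`. -/
def SatisfiesH1 {ι : Type} [Fintype ι] (G : Subgroup (WD ι)) : Prop :=
  ∀ H : Subgroup (WD ι), H ≤ G →
    Subsingleton (groupCohomology.H1 (Rep.of ((picRep ι).comp H.subtype)))

/-- Relative minimality: `Pic^G = ℤ l₀ ⊕ ℤ K`. -/
def IsRelativelyMinimal {ι : Type} [Fintype ι] (G : Subgroup (WD ι)) : Prop :=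
  Representation.invariants ((picRep ι).comp G.subtype) =
    Submodule.span ℤ {fiberClass ι, canonicalClass ι}

/-! ### The dihedral group `𝔇_{2n+1}`

Its index set is `Option (Fin (2n+1))`. The index `j ∈ {1, …, 2n+1}` is the element `j - 1` of
`Fin (2n+1)`, and the last index `2n+2`, the orbit of length one, is `none`. -/

/-- The product `c₁ c₂ ⋯ τ` of all `c_j` with the permutation `τ` of the indices other than the
last one. -/
def allSigns {M : Type} (τ : Perm M) : WB (Option M) := ⟨fun _ => -1, optionCongr τ⟩

/-- A permutation `τ` of the indices other than the last one, as a signed permutation. -/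
def noSigns {M : Type} (τ : Perm M) : WB (Option M) := ⟨1, optionCongr τ⟩

/-- The permutation `(2,3)(4,5)⋯(2n,2n+1)`, with indices lowered by one. -/
def dihedralPerm₁ (n : ℕ) : Perm (Fin (2 * n + 1)) :=
  Function.Involutive.toPerm
    (fun i => if (i : ℕ) = 0 then i
      else if h : (i : ℕ) % 2 = 1 then ⟨i + 1, by omega⟩ else ⟨i - 1, by omega⟩)
    (by
      intro i
      by_cases h0 : (i : ℕ) = 0
      · simp [h0]
      by_cases h1 : (i : ℕ) % 2 = 1
      · have h2 : ¬ ((i : ℕ) + 1) % 2 = 1 := by omega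
        ext; simp [h0, h1, h2]
      · have h2 : ((i : ℕ) - 1) % 2 = 1 := by omega
        have h3 : ¬ ((i : ℕ) - 1 = 0) := by omega
        ext; simp [h0, h1, h2, h3]; omega)

/-- The permutation `(1,2,4,…,2n,2n+1,2n-1,…,3)`, with indices lowered by one. -/
def dihedralPerm₂ (n : ℕ) : Perm (Fin (2 * n + 1)) :=
  List.formPerm
    (List.ofFn (fun k : Fin (2 * n + 1) =>
      if h : (k : ℕ) = 0 then k
      else if h' : (k : ℕ) ≤ n then ⟨2 * k - 1, by omega⟩
      else ⟨2 * (2 * n + 1 - k), by omega⟩))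

/-- `g₁ = c₁ c₂ ⋯ c_{2n+2} (2,3)(4,5)⋯(2n,2n+1)`. -/
def dihedralGen₁ (n : ℕ) : WB (Option (Fin (2 * n + 1))) := allSigns (dihedralPerm₁ n)

/-- `g₂ = (1,2,4,…,2n,2n+1,2n-1,…,3)`. -/
def dihedralGen₂ (n : ℕ) : WB (Option (Fin (2 * n + 1))) := noSigns (dihedralPerm₂ n)

/-- The group `𝔇_{2n+1}`. -/
def dihedral (n : ℕ) : Subgroup (WB (Option (Fin (2 * n + 1)))) :=
  Subgroup.closure {dihedralGen₁ n, dihedralGen₂ n}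

/-! ### The Frobenius group `𝔉_{p^r}`

The field with `p^r` elements is `(ℤ/p)[x]/(h)`, with `h` monic irreducible of degree `r`, and
`Γ` is a generator of its group of units. The index set is `Option (Fin (p^r))`. The index
`j ∈ {1, …, p^r - 1}` is the element `j` of `Fin (p^r)`, the index `p^r` is the element `0` of
`Fin (p^r)`, and the last index `p^r + 1`, the orbit of length one, is `none`. -/

section Frobenius

open Polynomial

/-- The labelling `[a₀ + a₁ x + ⋯ + a_{r-1} x^{r-1}] ↦ a₀ + a₁ p + ⋯ + a_{r-1} p^{r-1}`, with
`0 ≤ aᵢ < p`, where the label `0` stands for the index `p^r`. -/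
def lab (p : ℕ) [NeZero p] {h : (ZMod p)[X]} (hm : h.Monic) :
    AdjoinRoot h ≃ Fin (p ^ h.natDegree) :=
  ((AdjoinRoot.powerBasisAux' hm).equivFun.toEquiv.trans
    (Equiv.piCongrRight fun _ => (ZMod.finEquiv p).symm.toEquiv)).trans finFunctionFinEquiv

/-- The cycle `(lab 1, lab Γ, lab Γ², …)`: multiplication by `Γ` on labels. -/
def frobeniusPerm₁ (p : ℕ) [NeZero p] {h : (ZMod p)[X]} (hm : h.Monic) (Γ : (AdjoinRoot h)ˣ) :
    Perm (Fin (p ^ h.natDegree)) :=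
  (lab p hm).permCongr Γ.mulLeft

/-- The permutation `(p^r,1,…,p-1)(p,p+1,…,2p-1)⋯(p^r-p,…,p^r-1)`, where the index `p^r` is written
as `0`: on each block `{k p, …, k p + p - 1}` it is the cyclic shift by one. -/
def frobeniusPerm₂ (p r : ℕ) (hr : 0 < r) : Perm (Fin (p ^ r)) :=
  ((finProdFinEquiv (m := p ^ (r - 1)) (n := p)).trans
    (finCongr (pow_sub_one_mul hr.ne' p))).permCongr
    (Equiv.prodCongr (Equiv.refl _) (finRotate p))

/-- `g₁ = c₁ ⋯ c_{p^r+1} (1, lab Γ, …, lab Γ^{p^r-2})`. -/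
def frobeniusGen₁ (p : ℕ) [NeZero p] {h : (ZMod p)[X]} (hm : h.Monic) (Γ : (AdjoinRoot h)ˣ) :
    WB (Option (Fin (p ^ h.natDegree))) :=
  allSigns (frobeniusPerm₁ p hm Γ)

/-- `g₂ = (p^r,1,…,p-1)(p,p+1,…,2p-1)⋯(p^r-p,…,p^r-1)`. -/
def frobeniusGen₂ (p r : ℕ) (hr : 0 < r) : WB (Option (Fin (p ^ r))) :=
  noSigns (frobeniusPerm₂ p r hr)

/-- The group `𝔉_{p^r}`, where `r` is the degree of `h`. -/
def frobenius (p : ℕ) [NeZero p] {h : (ZMod p)[X]} (hm : h.Monic) (hr : 0 < h.natDegree)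
    (Γ : (AdjoinRoot h)ˣ) : Subgroup (WB (Option (Fin (p ^ h.natDegree)))) :=
  Subgroup.closure {frobeniusGen₁ p hm Γ, frobeniusGen₂ p h.natDegree hr}

end Frobenius

/-! ### Products with identified orbits of length one -/

/-- Extension of signed permutations along an injection of index sets, by the identity on the
indices outside the image. -/
def extend {ι κ : Type} (f : ι ↪ κ) : WB ι →* WB κ :=
  SemidirectProduct.map (Function.ExtendByOne.hom ℤˣ f) (Perm.viaEmbeddingHom f) (by
    intro τ
    refine MonoidHom.ext fun s => funext fun k => ?_
    have hv : ∀ i, (Perm.viaEmbeddingHom f τ)⁻¹ (f i) = f (τ⁻¹ i) := by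
      intro i
      rw [← map_inv, Perm.viaEmbeddingHom_apply, Perm.viaEmbedding_apply]
    change Function.extend f (fun i => s (τ⁻¹ i)) 1 k
      = Function.extend f s 1 ((Perm.viaEmbeddingHom f τ)⁻¹ k)
    by_cases hk : ∃ i, f i = k
    · obtain ⟨i, rfl⟩ := hk
      rw [hv, f.injective.extend_apply, f.injective.extend_apply]
    · have : (Perm.viaEmbeddingHom f τ)⁻¹ k = k := by
        rw [← map_inv, Perm.viaEmbeddingHom_apply,
          Perm.viaEmbedding_apply_of_notMem _ _ _ (by simpa using hk)]
      rw [this, Function.extend_apply' _ _ _ hk, Function.extend_apply' _ _ _ hk])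

/-- Two index sets `Option M` and `Option M'` are glued along their last indices `none` to the
index set `Option (M ⊕ M')`. This is the extension of signed permutations of the first one. -/
def glueLeft (M M' : Type) : WB (Option M) →* WB (Option (M ⊕ M')) :=
  extend (Function.Embedding.optionMap Function.Embedding.inl)

/-- The extension of signed permutations of the second index set. -/
def glueRight (M M' : Type) : WB (Option M') →* WB (Option (M ⊕ M')) :=
  extend (Function.Embedding.optionMap Function.Embedding.inr)

/-- The group generated by `G` and `G'` after identification of their last indices. -/
def gluedProduct {M M' : Type} (G : Subgroup (WB (Option M))) (G' : Subgroup (WB (Option M'))) :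
    Subgroup (WB (Option (M ⊕ M'))) :=
  G.map (glueLeft M M') ⊔ G'.map (glueRight M M')

/-- The glued group is the direct product of `G` and `G'`. -/
def IsDirectProduct {M M' : Type} (G : Subgroup (WB (Option M)))
    (G' : Subgroup (WB (Option M'))) : Prop :=
  ∃ e : G × G' ≃* gluedProduct G G', ∀ (g : G) (g' : G'),
    ((e (g, g') : gluedProduct G G') : WB (Option (M ⊕ M')))
      = glueLeft M M' g * glueRight M M' g'

end ConicBundle

end

/-!
Let `f` be a 1-cocycle with values in the Picard lattice. Its `l₋₁`-coordinate vanishes, so its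
`lᵢ`-coordinates form a cocycle for the signed permutation action on `ℤ^ι`, and twice such a cocycle
is the coboundary of some `Y`, obtained by transporting along each orbit a value at one index that
is compatible with its stabilizer. Such a value has a parity, constant along the orbit, which is
free at an index not fixed by any element of sign `-1`. On a block of odd size the parities can be
chosen equal, because its points that are fixed by elements of sign `-1` lie in one orbit. The
`l₀`-coordinate forces the parities of different blocks to agree. Once all values of `Y` have the
same parity, adding a combination of `K` and `l₀`, which are invariant, makes `Y` divisible by 2,
and half of the result trivializes `f`.

For relative minimality, an element of sign `-1` fixing the index `i` forces `2 xᵢ + a = 0` for an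
invariant class `a l₋₁ + b l₀ + ∑ xᵢ lᵢ`. Now `𝔇_{2n+1}` and `𝔉_{p^r}` act on the indices other than
the last one by affine maps `y ↦ γ ^ k y + b` with sign `(-1) ^ k`, where `γ ^ k - 1` is a unit for
odd `k`: an element of sign `-1` has at most one fixed point, and every index is such a point.
-/

namespace ConicBundle

section OddAction

variable {H M : Type*} [Group H] [MulAction H M]

lemma exists_odd_card_orbit (hM : Odd (Nat.card M)) :
    ∃ z : M, Odd (Nat.card (MulAction.orbit H z)) := by
  by_contra! h
  have : Finite M := Nat.finite_of_card_ne_zero hM.pos.ne'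
  have := Fintype.ofFinite (MulAction.orbitRel.Quotient H M)
  rw [← Nat.not_even_iff_odd, Nat.card_congr (MulAction.selfEquivSigmaOrbits H M),
    Nat.card_sigma] at hM
  exact hM (Finset.even_sum _ fun ω _ => Nat.not_odd_iff_even.1 (h ω.out))

lemma exists_odd_pow_smul_eq (hM : Odd (Nat.card M)) (h : H) :
    ∃ n, Odd n ∧ ∃ w : M, h ^ n • w = w := by
  obtain ⟨w, hw⟩ := exists_odd_card_orbit (H := Subgroup.zpowers h) hM
  have := Nat.finite_of_card_ne_zero hw.pos.ne'
  have := Fintype.ofFinite (MulAction.orbit (Subgroup.zpowers h) w)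
  rw [Nat.card_eq_fintype_card, ← MulAction.minimalPeriod_eq_card] at hw
  exact ⟨_, hw, w, MulAction.pow_smul_eq_iff_minimalPeriod_dvd.2 dvd_rfl⟩

theorem exists_fixedBy_subset_orbit (hM : Odd (Nat.card M)) (χ : H →* ℤˣ)
    (hfix : ∀ h, χ h = -1 → (MulAction.fixedBy M h).Subsingleton) :
    ∃ z : M, ∀ h, χ h = -1 → MulAction.fixedBy M h ⊆ MulAction.orbit H z := by
  obtain ⟨z, hz⟩ := exists_odd_card_orbit (H := H) hM
  refine ⟨z, fun h hh i hi => ?_⟩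
  obtain ⟨n, hn, w, hw⟩ := exists_odd_pow_smul_eq hz h
  have hsign : χ (h ^ n) = -1 := by rw [map_pow, hh, hn.neg_one_pow]
  have hi' : i ∈ MulAction.fixedBy M (h ^ n) := by
    simpa only [zpow_natCast] using MulAction.mem_fixedBy_zpow hi n
  rw [hfix _ hsign hi' (congrArg Subtype.val hw)]
  exact w.2

end OddAction

section SignedCocycle

variable {H M : Type*} [Group H] [MulAction H M] {s : H → M → ℤˣ} {x : H → M → ℤ}

/-- A 1-cocycle `x` with values in the functions `M → ℤ`, on which the group acts by permuting the
points and by the signs `s`. -/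
structure IsSignedCocycle (s : H → M → ℤˣ) (x : H → M → ℤ) : Prop where
  sign_mul : ∀ g h i, s (g * h) i = s g i * s h (g⁻¹ • i)
  map_mul : ∀ g h i, x (g * h) i = x g i + s g i * x h (g⁻¹ • i)

/-- The affine action attached to a signed cocycle `x`, as a map from the values at `r` to the
values at `g • r`. A function invariant under it, that is `Y` with
`Y (g • r) = transport s x g r (Y r)`, exhibits `2 • x` as a coboundary. -/
def transport (s : H → M → ℤˣ) (x : H → M → ℤ) (g : H) (r : M) (c : ℤ) : ℤ :=
  s g (g • r) * c - 2 * x g (g • r)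

/-- The values at `r` which the stabilizer of `r` does not move, that is the possible values at
`r` of a function invariant under the affine action. -/
def IsAdmissible (s : H → M → ℤˣ) (x : H → M → ℤ) (r : M) (c : ℤ) : Prop :=
  ∀ u : H, u • r = r → transport s x u r c = c

lemma cast_transport (g : H) (r : M) (c : ℤ) : (transport s x g r c : ZMod 2) = c := by
  have h2 : (2 : ZMod 2) = 0 := rfl
  obtain hs | hs := Int.units_eq_one_or (s g (g • r)) <;>
    simp [transport, hs, h2, CharTwo.neg_eq]

namespace IsSignedCocycle

lemma transport_mul (hx : IsSignedCocycle s x) (g h : H) (r : M) (c : ℤ) :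
    transport s x (g * h) r c = transport s x g (h • r) (transport s x h r c) := by
  simp only [transport, hx.sign_mul, hx.map_mul, mul_smul, inv_smul_smul, Units.val_mul]
  ring

lemma map_one (hx : IsSignedCocycle s x) (i : M) : x 1 i = 0 := by
  have hs : s 1 i = 1 := by simpa using hx.sign_mul 1 1 i
  simpa [hs] using hx.map_mul 1 1 i

end IsSignedCocycle

lemma eq_zero_of_map_pow [Finite H] {a : H → ℤ} {u : H} (ha : ∀ n : ℕ, a (u ^ n) = n * a u) :
    a u = 0 := by
  have h0 : a 1 = 0 := by simpa using ha 0
  have hord := ha (orderOf u)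
  rw [pow_orderOf_eq_one, h0, zero_eq_mul] at hord
  exact hord.resolve_left (mod_cast (orderOf_pos u).ne')

lemma IsSignedCocycle.eq_zero_of_smul_eq [Finite H] (hx : IsSignedCocycle s x) {u : H} {r : M}
    (hu : u • r = r) (hs : s u r = 1) : x u r = 0 := by
  refine eq_zero_of_map_pow (a := fun g => x g r) fun n => ?_
  induction n with
  | zero => simp [hx.map_one]
  | succ n ih =>
    rw [pow_succ', hx.map_mul, hs, inv_smul_eq_iff.2 hu.symm, ih]
    push_cast
    ring

lemma IsAdmissible.transport_eq (hx : IsSignedCocycle s x) {r : M} {c : ℤ}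
    (hc : IsAdmissible s x r c) {g h : H} (hgh : g • r = h • r) :
    transport s x g r c = transport s x h r c := by
  have hu : (h⁻¹ * g) • r = r := by rw [mul_smul, hgh, inv_smul_smul]
  rw [← mul_inv_cancel_left h g, hx.transport_mul, hc _ hu, hu]

lemma IsAdmissible.smul (hx : IsSignedCocycle s x) {r : M} {c : ℤ}
    (hc : IsAdmissible s x r c) (g : H) : IsAdmissible s x (g • r) (transport s x g r c) :=
  fun u hu => (hx.transport_mul u g r c).symm.trans
    (hc.transport_eq hx (by rw [mul_smul, hu]))

lemma isAdmissible_of_sign_eq_one [Finite H] (hx : IsSignedCocycle s x) {r : M}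
    (hs : ∀ u : H, u • r = r → s u r = 1) (c : ℤ) : IsAdmissible s x r c := fun u hu => by
  rw [transport, hu, hs u hu, hx.eq_zero_of_smul_eq hu (hs u hu)]
  simp

lemma exists_isAdmissible [Finite H] (hx : IsSignedCocycle s x) (r : M) :
    ∃ c, IsAdmissible s x r c := by
  by_cases! hr : ∃ v : H, v • r = r ∧ s v r = -1
  · obtain ⟨v, hv, hsv⟩ := hr
    refine ⟨-x v r, fun u hu => ?_⟩
    rw [transport, hu]
    obtain hsu | hsu := Int.units_eq_one_or (s u r)
    · simp [hsu, hx.eq_zero_of_smul_eq hu hsu]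
    · have hu' : u⁻¹ • r = r := inv_smul_eq_iff.2 hu.symm
      have huv : x (u * v) r = 0 := hx.eq_zero_of_smul_eq (by rw [mul_smul, hv, hu])
        (by rw [hx.sign_mul, hu', hsu, hsv]; rfl)
      rw [hx.map_mul, hu', hsu] at huv
      rw [hsu]
      push_cast at huv ⊢
      linarith
  · exact ⟨0, isAdmissible_of_sign_eq_one hx
      (fun u hu => (Int.units_eq_one_or _).resolve_right (hr u hu)) 0⟩

theorem IsSignedCocycle.exists_invariant (hx : IsSignedCocycle s x) {ε : M → ZMod 2}
    (hε : ∀ (g : H) i, ε (g • i) = ε i)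
    (hadm : ∀ r, ∃ c : ℤ, IsAdmissible s x r c ∧ (c : ZMod 2) = ε r) :
    ∃ Y : M → ℤ, (∀ i, (Y i : ZMod 2) = ε i) ∧
      ∀ (g : H) i, Y (g • i) = transport s x g i (Y i) := by
  choose c hc hcε using hadm
  let rep (i : M) : M := (Quotient.mk (MulAction.orbitRel H M) i).out
  have hrep (i : M) : ∃ k : H, k • rep i = i :=
    MulAction.orbitRel_apply.1 ((MulAction.orbitRel H M).symm (Quotient.mk_out i))
  have rep_smul (g : H) (i : M) : rep (g • i) = rep i :=
    congrArg Quotient.out (Quotient.sound (MulAction.orbitRel_apply.2 ⟨g, rfl⟩))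
  choose k hk using hrep
  refine ⟨fun i => transport s x (k i) (rep i) (c (rep i)), fun i => ?_, fun g i => ?_⟩
  · rw [cast_transport, hcε, ← hε (k i), hk]
  · have hgk : k (g • i) • rep i = (g * k i) • rep i := by rw [mul_smul, hk, ← rep_smul g, hk]
    simp only [rep_smul]
    rw [(hc (rep i)).transport_eq hx hgk, hx.transport_mul, hk]

theorem IsSignedCocycle.exists_parity [Finite H] (hx : IsSignedCocycle s x) (B : SubMulAction H M)
    (hB : Odd (Nat.card B)) (χ : H →* ℤˣ) (hs : ∀ g, ∀ i ∈ B, s g i = χ g)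
    (hfix : ∀ g, χ g = -1 → (MulAction.fixedBy M g ∩ B).Subsingleton) :
    ∃ ε : ZMod 2, ∀ r ∈ B, ∃ c : ℤ, IsAdmissible s x r c ∧ (c : ZMod 2) = ε := by
  obtain ⟨z, hz⟩ := exists_fixedBy_subset_orbit hB χ fun g hg i hi j hj =>
    Subtype.ext (hfix g hg ⟨congrArg Subtype.val hi, i.2⟩ ⟨congrArg Subtype.val hj, j.2⟩)
  obtain ⟨c, hc⟩ := exists_isAdmissible hx (z : M)
  refine ⟨c, fun r hr => ?_⟩
  by_cases hrz : (⟨r, hr⟩ : B) ∈ MulAction.orbit H z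
  · obtain ⟨g, hg⟩ := hrz
    obtain rfl : g • (z : M) = r := congrArg Subtype.val hg
    exact ⟨_, hc.smul hx g, cast_transport g _ c⟩
  · refine ⟨c, isAdmissible_of_sign_eq_one hx (fun u hu => ?_) c, rfl⟩
    rw [hs u r hr]
    exact (Int.units_eq_one_or _).resolve_right fun hχ => hrz (hz u hχ (Subtype.ext hu))

end SignedCocycle

section CommonParity

variable {Q : Type*} [Group Q]

lemma exists_map_eq_neg_one_of_ne_one {χ ψ : Q →* ℤˣ} (hχ : χ ≠ 1) (hψ : ψ ≠ 1) :
    ∃ q, χ q = -1 ∧ ψ q = -1 := by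
  obtain ⟨q, hq⟩ := DFunLike.ne_iff.1 hχ
  obtain ⟨q', hq'⟩ := DFunLike.ne_iff.1 hψ
  replace hq : χ q = -1 := (Int.units_eq_one_or _).resolve_left hq
  replace hq' : ψ q' = -1 := (Int.units_eq_one_or _).resolve_left hq'
  obtain h | h := Int.units_eq_one_or (ψ q)
  · obtain h' | h' := Int.units_eq_one_or (χ q')
    · exact ⟨q * q', by rw [map_mul, hq, h', mul_one], by rw [map_mul, h, hq', one_mul]⟩
    · exact ⟨q', h', hq'⟩
  · exact ⟨q, hq, h⟩

lemma filter_eq_pair_of_prod_eq_one :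
    ∀ {t : Fin 3 → ℤˣ} {k l : Fin 3}, ∏ j, t j = 1 → k ≠ l → t k = -1 → t l = -1 →
      ({j | t j = -1} : Finset (Fin 3)) = {k, l} := by
  decide

theorem exists_common_parity {χ : Fin 3 → Q →* ℤˣ} (hχ : ∀ q, ∏ k, χ k q = 1)
    {A : Fin 3 → ZMod 2 → Prop} (hne : ∀ k, ∃ ε, A k ε) (htriv : ∀ k, χ k = 1 → ∀ ε, A k ε)
    (hrel : ∀ ε : Fin 3 → ZMod 2, (∀ k, A k (ε k)) → ∀ q, ∑ k with χ k q = -1, ε k = 0) :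
    ∃ ε, ∀ k, A k ε := by
  choose ε hε using hne
  have heq : ∀ k l, χ k ≠ 1 → χ l ≠ 1 → ε k = ε l := fun k l hk hl => by
    by_cases hkl : k = l
    · rw [hkl]
    · obtain ⟨q, hqk, hql⟩ := exists_map_eq_neg_one_of_ne_one hk hl
      have hsum := hrel ε hε q
      rwa [filter_eq_pair_of_prod_eq_one (t := fun k => χ k q) (hχ q) hkl hqk hql,
        Finset.sum_pair hkl, CharTwo.add_eq_zero] at hsum
  by_cases! h : ∃ k, χ k ≠ 1
  · obtain ⟨k, hk⟩ := h
    refine ⟨ε k, fun l => ?_⟩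
    by_cases hl : χ l = 1
    · exact htriv l hl _
    · exact heq k l hk hl ▸ hε l
  · exact ⟨0, fun k => htriv k (h k) 0⟩

end CommonParity

lemma eq_zero_of_map_mul {Q : Type*} [Group Q] [Finite Q] {a : Q → ℤ}
    (ha : ∀ q q', a (q * q') = a q + a q') (q : Q) : a q = 0 := by
  refine eq_zero_of_map_pow fun n => ?_
  induction n with
  | zero => simpa using ha 1 1
  | succ n ih =>
    rw [pow_succ, ha, ih]
    push_cast
    ring

section Cohomology

variable {ι : Type}

instance [Finite ι] : Finite (WB ι) := Finite.of_equiv _ SemidirectProduct.equivProd.symm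

/-- The signed permutation `c_{j₁} ⋯ c_{jₜ} τ` acts on the indices through `τ`. -/
instance : MulAction (WB ι) ι := MulAction.compHom ι SemidirectProduct.rightHom

lemma exists_two_smul_sub_mem_span {Y : ι → ℤ} {ε : ZMod 2} (hY : ∀ i, (Y i : ZMod 2) = ε) :
    ∃ v : Pic ι, (2 : ℤ) • v - (0, 0, Y) ∈ Submodule.span ℤ {fiberClass ι, canonicalClass ι} := by
  obtain ⟨a, rfl⟩ := ZMod.intCast_surjective ε
  have hdvd : ∀ i, (2 : ℤ) ∣ Y i - a := fun i =>
    (ZMod.intCast_eq_intCast_iff_dvd_sub a (Y i) 2).1 (hY i).symm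
  choose X hX using hdvd
  refine ⟨(-a, 0, fun i => X i + a), Submodule.mem_span_pair.2 ⟨2 * a, a, ?_⟩⟩
  refine Prod.ext ?_ (Prod.ext ?_ (funext fun i => ?_)) <;>
    simp only [fiberClass, canonicalClass, Prod.smul_mk, Prod.mk_add_mk, Prod.mk_sub_mk,
      Pi.smul_apply, Pi.add_apply, Pi.sub_apply, Pi.zero_apply, smul_eq_mul]
  · ring
  · ring
  · linear_combination hX i

lemma mem_span_fiberClass_canonicalClass [Nonempty ι] {v : Pic ι}
    (hv : ∀ i, 2 * v.2.2 i + v.1 = 0) :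
    v ∈ Submodule.span ℤ {fiberClass ι, canonicalClass ι} := by
  obtain ⟨i₀⟩ := ‹Nonempty ι›
  refine Submodule.mem_span_pair.2 ⟨v.2.1 + 2 * v.2.2 i₀, v.2.2 i₀, ?_⟩
  refine Prod.ext ?_ (Prod.ext ?_ (funext fun i => ?_)) <;>
    simp only [fiberClass, canonicalClass, Prod.smul_mk, Prod.mk_add_mk, Pi.smul_apply,
      Pi.add_apply, Pi.zero_apply, smul_eq_mul]
  · linarith [hv i₀]
  · ring
  · linarith [hv i₀, hv i]

variable [Fintype ι]

lemma picMap_fiberClass (g : WB ι) : picMap g (fiberClass ι) = fiberClass ι := by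
  simp [picMap, fiberClass, funext_iff]

lemma picMap_canonicalClass {g : WB ι} (hg : g ∈ WD ι) :
    picMap g (canonicalClass ι) = canonicalClass ι := by
  have hneg : 2 * (numNeg g / 2) = ∑ i, neg g i := Int.mul_ediv_cancel' (numNeg_even hg)
  refine Prod.ext rfl (Prod.ext ?_ (funext fun i => ?_))
  · simp [picMap, canonicalClass, ← hneg]
  · simp [picMap, canonicalClass, left_eq]

lemma picMap_eq_self_of_mem_span {g : WB ι} (hg : g ∈ WD ι) {v : Pic ι}
    (hv : v ∈ Submodule.span ℤ {fiberClass ι, canonicalClass ι}) : picMap g v = v := by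
  obtain ⟨a, b, rfl⟩ := Submodule.mem_span_pair.1 hv
  rw [map_add, map_smul, map_smul, picMap_fiberClass, picMap_canonicalClass hg]

variable {H : Subgroup (WD ι)} {f : H → Pic ι}

/-- The 1-cocycles of `H` with values in the Picard lattice. -/
abbrev picCocycles (H : Subgroup (WD ι)) : Submodule ℤ (H → Pic ι) :=
  groupCohomology.cocycles₁ (Rep.of ((picRep ι).comp H.subtype))

lemma mem_picCocycles : f ∈ picCocycles H ↔
    ∀ g h : H, f (g * h) = picMap (g : WB ι) (f h) + f g :=
  groupCohomology.mem_cocycles₁_iff (A := Rep.of ((picRep ι).comp H.subtype)) f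

lemma fst_eq_zero_of_mem_picCocycles (hf : f ∈ picCocycles H) (q : H) : (f q).1 = 0 :=
  eq_zero_of_map_mul (a := fun q => (f q).1)
    (fun g h => (congrArg Prod.fst (mem_picCocycles.1 hf g h)).trans (add_comm _ _)) q

lemma isSignedCocycle_of_mem_picCocycles (hf : f ∈ picCocycles H) :
    IsSignedCocycle (fun (q : H) i => (q : WB ι).left i) (fun q i => (f q).2.2 i) where
  sign_mul _ _ _ := rfl
  map_mul g h i := by
    have h3 : (f (g * h)).2.2 i =
        (g : WB ι).left i * (f h).2.2 (g⁻¹ • i) - (f h).1 * neg (g : WB ι) i + (f g).2.2 i :=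
      congrFun (congrArg (fun v : Pic ι => v.2.2) (mem_picCocycles.1 hf g h)) i
    rw [h3, fst_eq_zero_of_mem_picCocycles hf]
    ring

lemma eq_zero_of_mem_picCocycles (hf : f ∈ picCocycles H) (h0 : ∀ q, (f q).2.2 = 0) : f = 0 := by
  have hmid (q : H) : (f q).2.1 = 0 := by
    refine eq_zero_of_map_mul (a := fun q => (f q).2.1) (fun g h => ?_) q
    rw [mem_picCocycles.1 hf g h]
    simp [picMap, fst_eq_zero_of_mem_picCocycles hf h, h0 h, add_comm]
  exact funext fun q => Prod.ext (fst_eq_zero_of_mem_picCocycles hf q) (Prod.ext (hmid q) (h0 q))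

lemma two_smul_eq_of_invariant (hf : f ∈ picCocycles H) {Y : ι → ℤ}
    (hY : ∀ (q : H) i, Y (q • i) =
      transport (fun (q : H) i => (q : WB ι).left i) (fun q i => (f q).2.2 i) q i (Y i)) (q : H) :
    (2 : ℤ) • f q = picMap (q : WB ι) (0, 0, Y) - (0, 0, Y) := by
  have hcob : (fun q : H => picMap (q : WB ι) (0, 0, Y) - (0, 0, Y)) ∈ picCocycles H :=
    groupCohomology.d₀₁_apply_mem_cocycles₁ (A := Rep.of ((picRep ι).comp H.subtype)) (0, 0, Y)
  have hsub := (picCocycles H).sub_mem ((picCocycles H).smul_mem 2 hf) hcob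
  refine sub_eq_zero.1 (congrFun (eq_zero_of_mem_picCocycles hsub fun q => funext fun i => ?_) q)
  have hYi := hY q (q⁻¹ • i)
  rw [transport, smul_inv_smul] at hYi
  change 2 * (f q).2.2 i - ((q : WB ι).left i * Y (q⁻¹ • i) - 0 * neg (q : WB ι) i - Y i) = 0
  linear_combination hYi

/-- A signed permutation respects a partition `c` of the indices into blocks if it preserves each
block, is constant in sign on it and, where this sign is `-1`, fixes at most one of its points. -/
structure IsBlockSigned {κ : Type*} (c : ι → κ) (g : WB ι) : Prop where
  block_smul : ∀ i, c (g • i) = c i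
  left_eq : ∀ i j, c i = c j → g.left i = g.left j
  eq_of_fixed : ∀ i j, c i = c j → g.left i = -1 → g • i = i → g • j = j → i = j

lemma exists_blockSign {κ : Type*} {c : ι → κ} (hc : Function.Surjective c)
    (hH : ∀ q : H, IsBlockSigned c (q : WB ι)) :
    ∃ χ : κ → H →* ℤˣ, ∀ (q : H) i, (q : WB ι).left i = χ (c i) q := by
  choose rep hrep using hc
  refine ⟨fun k => MonoidHom.mk' (fun q => (q : WB ι).left (rep k)) fun q q' => ?_,
    fun q i => (hH q).left_eq _ _ (hrep _).symm⟩
  have hblock : c (q⁻¹ • rep k) = c (rep k) := (hH q⁻¹).block_smul _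
  change (q : WB ι).left (rep k) * (q' : WB ι).left (q⁻¹ • rep k) = _
  rw [(hH q').left_eq _ _ hblock]

@[to_additive]
lemma prod_comp_of_odd_card_fiber {κ A : Type*} [Fintype κ] [CommMonoid A] (hA : ∀ a : A, a ^ 2 = 1)
    {c : ι → κ} (hc : ∀ k, Odd (Nat.card {i // c i = k})) (t : κ → A) :
    ∏ i, t (c i) = ∏ k, t k := by
  classical
  rw [← Fintype.prod_fiberwise' c t]
  refine Finset.prod_congr rfl fun k _ => ?_
  obtain ⟨m, hm⟩ := hc k
  rw [Finset.prod_const, Finset.card_univ, ← Nat.card_eq_fintype_card, hm, pow_succ, pow_mul, hA,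
    one_pow, one_mul]

lemma sum_filter_eq_zero_of_two_smul_eq {κ : Type*} [Fintype κ] {c : ι → κ}
    (hodd : ∀ k, Odd (Nat.card {i // c i = k})) {g : WB ι} (hc : ∀ i, c (g • i) = c i)
    {t : κ → ℤˣ} (ht : ∀ i, g.left i = t (c i)) {Y : ι → ℤ} {ε : κ → ZMod 2}
    (hY : ∀ i, (Y i : ZMod 2) = ε (c i)) {w : Pic ι}
    (hw : (2 : ℤ) • w = picMap g (0, 0, Y) - (0, 0, Y)) :
    ∑ k with t k = -1, ε k = 0 := by
  have hmid : 2 * w.2.1 = 0 + 0 * (numNeg g / 2) + ∑ i, neg g i * Y (g⁻¹ • i) - 0 :=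
    congrArg (fun v : Pic ι => v.2.1) hw
  have hterm (i : ι) : (neg g i * Y (g⁻¹ • i) : ZMod 2) = if t (c i) = -1 then ε (c i) else 0 := by
    have hblock : c (g⁻¹ • i) = c i := by rw [← hc, smul_inv_smul]
    simp [neg, ht, hY, hblock]
  calc ∑ k with t k = -1, ε k
    _ = ∑ i, if t (c i) = -1 then ε (c i) else 0 := by
      rw [sum_comp_of_odd_card_fiber CharTwo.two_nsmul hodd fun k => if t k = -1 then ε k else 0,
        Finset.sum_filter]
    _ = ((∑ i, neg g i * Y (g⁻¹ • i) : ℤ) : ZMod 2) := by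
      push_cast
      exact Finset.sum_congr rfl fun i _ => (hterm i).symm
    _ = ((2 * w.2.1 : ℤ) : ZMod 2) := by rw [hmid]; simp
    _ = 0 := (ZMod.intCast_zmod_eq_zero_iff_dvd _ 2).2 ⟨_, rfl⟩

theorem exists_two_smul_eq_of_mem_picCocycles {c : ι → Fin 3}
    (hodd : ∀ k, Odd (Nat.card {i // c i = k})) (hH : ∀ q : H, IsBlockSigned c (q : WB ι))
    (hf : f ∈ picCocycles H) :
    ∃ (ε : ZMod 2) (Y : ι → ℤ), (∀ i, (Y i : ZMod 2) = ε) ∧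
      ∀ q : H, (2 : ℤ) • f q = picMap (q : WB ι) (0, 0, Y) - (0, 0, Y) := by
  have hx := isSignedCocycle_of_mem_picCocycles hf
  have hsurj : Function.Surjective c := fun k => by
    obtain ⟨⟨i, hi⟩⟩ := (Nat.card_pos_iff.1 (hodd k).pos).1
    exact ⟨i, hi⟩
  obtain ⟨χ, hχ⟩ := exists_blockSign hsurj hH
  let A (k : Fin 3) (ε : ZMod 2) : Prop := ∀ r, c r = k → ∃ a : ℤ,
    IsAdmissible (fun (q : H) i => (q : WB ι).left i) (fun q i => (f q).2.2 i) r a ∧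
      (a : ZMod 2) = ε
  have exists_Y (ε : Fin 3 → ZMod 2) (hε : ∀ k, A k (ε k)) :
      ∃ Y : ι → ℤ, (∀ i, (Y i : ZMod 2) = ε (c i)) ∧
        ∀ q : H, (2 : ℤ) • f q = picMap (q : WB ι) (0, 0, Y) - (0, 0, Y) := by
    obtain ⟨Y, hYε, hY⟩ := hx.exists_invariant (ε := ε ∘ c)
      (fun q i => congrArg ε ((hH q).block_smul i)) fun r => hε (c r) r rfl
    exact ⟨Y, hYε, two_smul_eq_of_invariant hf hY⟩
  obtain ⟨ε, hε⟩ : ∃ ε, ∀ k, A k ε := by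
    refine exists_common_parity (χ := χ) (fun q => ?_) (fun k => ?_) (fun k hk ε r hr => ?_)
      fun ε hε q => ?_
    · rw [← prod_comp_of_odd_card_fiber Int.units_sq hodd,
        ← Finset.prod_congr rfl fun i _ => hχ q i]
      exact q.1.2
    · refine hx.exists_parity ⟨{i | c i = k}, fun q i hi => ((hH q).block_smul i).trans hi⟩ (hodd k)
        (χ k) (fun q i hi => (hχ q i).trans (by rw [hi])) fun q hq i hi j hj => ?_
      exact (hH q).eq_of_fixed i j (hi.2.trans hj.2.symm) (by rw [hχ, hi.2, hq]) hi.1 hj.1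
    · obtain ⟨a, ha⟩ := ZMod.intCast_surjective ε
      refine ⟨a, isAdmissible_of_sign_eq_one hx (fun q _ => ?_) a, ha⟩
      rw [hχ, hr, hk, MonoidHom.one_apply]
    · obtain ⟨Y, hYε, hY⟩ := exists_Y ε hε
      exact sum_filter_eq_zero_of_two_smul_eq hodd (hH q).block_smul (hχ q) hYε (hY q)
  obtain ⟨Y, hYε, hY⟩ := exists_Y (fun _ => ε) hε
  exact ⟨ε, Y, hYε, hY⟩

theorem satisfiesH1_of_isBlockSigned {c : ι → Fin 3} (hodd : ∀ k, Odd (Nat.card {i // c i = k}))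
    {G : Subgroup (WD ι)} (hG : ∀ g ∈ G, IsBlockSigned c (g : WB ι)) : SatisfiesH1 G := by
  refine fun H hH => subsingleton_of_forall_eq 0 fun y => ?_
  induction y using groupCohomology.H1_induction_on with
  | h f =>
    obtain ⟨ε, Y, hYε, hY⟩ :=
      exists_two_smul_eq_of_mem_picCocycles hodd (fun q : H => hG q (hH q.2)) f.2
    obtain ⟨v, hv⟩ := exists_two_smul_sub_mem_span hYε
    refine (groupCohomology.H1π_eq_zero_iff f).2 ⟨v, funext fun q => ?_⟩
    have hinv := picMap_eq_self_of_mem_span q.1.2 hv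
    have hdouble : (2 : ℤ) • (picMap (q : WB ι) v - v) = (2 : ℤ) • f.1 q := by
      rw [map_sub, map_smul] at hinv
      rw [hY, smul_sub, sub_eq_sub_iff_sub_eq_sub, hinv]
    exact smul_right_injective (Pic ι) (two_ne_zero' ℤ) hdouble

lemma two_mul_add_eq_zero_of_picMap_eq {g : WB ι} {v : Pic ι} (hv : picMap g v = v) {i : ι}
    (hi : g • i = i) (hs : g.left i = -1) : 2 * v.2.2 i + v.1 = 0 := by
  have h := congrFun (congrArg (fun v : Pic ι => v.2.2) hv) i
  change (g.left i : ℤ) * v.2.2 (g⁻¹ • i) - v.1 * neg g i = v.2.2 i at h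
  rw [inv_smul_eq_iff.2 hi.symm, neg, if_pos hs, hs] at h
  push_cast at h
  linarith

theorem isRelativelyMinimal_of_exists_fixed [Nonempty ι] {G : Subgroup (WD ι)}
    (hG : ∀ i, ∃ g ∈ G, (g : WB ι) • i = i ∧ (g : WB ι).left i = -1) : IsRelativelyMinimal G := by
  refine le_antisymm (fun v hv => mem_span_fiberClass_canonicalClass fun i => ?_)
    fun v hv g => picMap_eq_self_of_mem_span g.1.2 hv
  obtain ⟨g, hg, hi, hs⟩ := hG i
  exact two_mul_add_eq_zero_of_picMap_eq (hv ⟨g, hg⟩) hi hs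

end Cohomology

section Gluing

lemma extend_left_apply {ι κ : Type} (f : ι ↪ κ) (g : WB ι) (i : ι) :
    (extend f g).left (f i) = g.left i :=
  f.injective.extend_apply g.left 1 i

lemma extend_left_of_notMem {ι κ : Type} (f : ι ↪ κ) (g : WB ι) {k : κ} (hk : k ∉ Set.range f) :
    (extend f g).left k = 1 :=
  Function.extend_apply' g.left (1 : κ → ℤˣ) k hk

lemma extend_right_apply {ι κ : Type} (f : ι ↪ κ) (g : WB ι) (i : ι) :
    (extend f g).right (f i) = f (g.right i) :=
  Perm.viaEmbedding_apply _ _ _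

lemma extend_right_of_notMem {ι κ : Type} (f : ι ↪ κ) (g : WB ι) {k : κ} (hk : k ∉ Set.range f) :
    (extend f g).right k = k :=
  Perm.viaEmbedding_apply_of_notMem _ _ _ hk

variable {M M' : Type}

/-- The signed permutation with constant sign `p.1` that fixes the last index and permutes the
other ones by `p.2`; `allSigns τ` and `noSigns τ` are its values at `(-1, τ)` and `(1, τ)`. -/
def uniform : ℤˣ × Perm M →* WB (Option M) where
  toFun p := ⟨fun _ => p.1, optionCongr p.2⟩
  map_one' := SemidirectProduct.ext rfl optionCongr_refl
  map_mul' _ _ := SemidirectProduct.ext rfl (Equiv.ext (by rintro (_ | _) <;> rfl))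

lemma uniform_injective :
    Function.Injective (uniform : ℤˣ × Perm M →* WB (Option M)) := fun _ _ h =>
  Prod.ext (congrFun (congrArg SemidirectProduct.left h) none)
    (optionCongr_injective (congrArg SemidirectProduct.right h))

/-- The three blocks of the glued index set: the indices coming only from `M`, those coming only
from `M'`, and the common last index. -/
def block : Option (M ⊕ M') → Fin 3
  | some (Sum.inl _) => 0
  | some (Sum.inr _) => 1
  | none => 2

/-- The product of the extensions of `uniform p` and `uniform p'` to the glued index set; the two
signs are multiplied at the common last index. -/
def glued : (ℤˣ × Perm M) × (ℤˣ × Perm M') →* WB (Option (M ⊕ M')) where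
  toFun p := ⟨fun o => ![p.1.1, p.2.1, p.1.1 * p.2.1] (block o),
    optionCongr (sumCongr p.1.2 p.2.2)⟩
  map_one' := SemidirectProduct.ext (by funext o; rcases o with _ | _ | _ <;> rfl)
    (Equiv.ext (by rintro (_ | _ | _) <;> rfl))
  map_mul' p q := SemidirectProduct.ext
    (by funext o; rcases o with _ | _ | _ <;> first | rfl | exact mul_mul_mul_comm _ _ _ _)
    (Equiv.ext (by rintro (_ | _ | _) <;> rfl))

lemma glueLeft_uniform (p : ℤˣ × Perm M) : glueLeft M M' (uniform p) = glued (p, 1) := by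
  refine SemidirectProduct.ext (funext fun o => ?_) (Equiv.ext fun o => ?_) <;>
    rcases o with _ | i | j
  · exact (extend_left_apply _ _ none).trans (mul_one p.1).symm
  · exact extend_left_apply _ _ (some i)
  · exact extend_left_of_notMem _ _ (by rintro ⟨_ | i, h⟩ <;> simp at h)
  · exact extend_right_apply _ _ none
  · exact extend_right_apply _ _ (some i)
  · exact extend_right_of_notMem _ _ (by rintro ⟨_ | i, h⟩ <;> simp at h)

lemma glueRight_uniform (p : ℤˣ × Perm M') : glueRight M M' (uniform p) = glued (1, p) := by
  refine SemidirectProduct.ext (funext fun o => ?_) (Equiv.ext fun o => ?_) <;>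
    rcases o with _ | i | j
  · exact (extend_left_apply _ _ none).trans (one_mul p.1).symm
  · exact extend_left_of_notMem _ _ (by rintro ⟨_ | i, h⟩ <;> simp at h)
  · exact extend_left_apply _ _ (some j)
  · exact extend_right_apply _ _ none
  · exact extend_right_of_notMem _ _ (by rintro ⟨_ | i, h⟩ <;> simp at h)
  · exact extend_right_apply _ _ (some j)

lemma glueLeft_mul_glueRight_uniform (p : ℤˣ × Perm M) (p' : ℤˣ × Perm M') :
    glueLeft M M' (uniform p) * glueRight M M' (uniform p') = glued (p, p') := by
  rw [glueLeft_uniform, glueRight_uniform, ← map_mul, Prod.mk_mul_mk, mul_one, one_mul]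

lemma commute_glueLeft_glueRight_uniform (p : ℤˣ × Perm M) (p' : ℤˣ × Perm M') :
    Commute (glueLeft M M' (uniform p)) (glueRight M M' (uniform p')) := by
  rw [glueLeft_uniform, glueRight_uniform]
  exact (MonoidHom.commute_inl_inr p p').map glued

lemma glued_injective [Nonempty M] [Nonempty M'] :
    Function.Injective (glued : (ℤˣ × Perm M) × (ℤˣ × Perm M') →* WB (Option (M ⊕ M'))) := by
  intro p q h
  have hleft := congrFun (congrArg SemidirectProduct.left h)
  obtain ⟨hright, hright'⟩ := Prod.mk_inj.1 <| Perm.sumCongrHom_injective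
    (a₁ := (p.1.2, p.2.2)) (a₂ := (q.1.2, q.2.2))
    (optionCongr_injective (congrArg SemidirectProduct.right h))
  obtain ⟨i⟩ := ‹Nonempty M›
  obtain ⟨j⟩ := ‹Nonempty M'›
  exact Prod.ext (Prod.ext (hleft (some (Sum.inl i))) hright)
    (Prod.ext (hleft (some (Sum.inr j))) hright')

variable {G : Subgroup (WB (Option M))} {G' : Subgroup (WB (Option M'))}

theorem isDirectProduct_of_le_range_uniform [Nonempty M] [Nonempty M']
    (hG : G ≤ (uniform (M := M)).range) (hG' : G' ≤ (uniform (M := M')).range) :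
    IsDirectProduct G G' := by
  let φ : G × G' →* WB (Option (M ⊕ M')) :=
    ((glueLeft M M').comp G.subtype).noncommCoprod ((glueRight M M').comp G'.subtype)
      fun g g' => by
        obtain ⟨p, hp⟩ := hG g.2
        obtain ⟨p', hp'⟩ := hG' g'.2
        simpa only [MonoidHom.comp_apply, Subgroup.subtype_apply, ← hp, ← hp'] using
          commute_glueLeft_glueRight_uniform p p'
  have hφ : Function.Injective φ := by
    rw [injective_iff_map_eq_one]
    rintro ⟨⟨_, hg⟩, ⟨_, hg'⟩⟩ h
    obtain ⟨p, rfl⟩ := hG hg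
    obtain ⟨p', rfl⟩ := hG' hg'
    have h1 : glued (p, p') = 1 := (glueLeft_mul_glueRight_uniform p p').symm.trans h
    obtain ⟨rfl, rfl⟩ := Prod.mk_eq_one.1 ((map_eq_one_iff glued glued_injective).1 h1)
    exact Prod.ext (Subtype.ext (map_one _)) (Subtype.ext (map_one _))
  have hrange : φ.range = gluedProduct G G' := by
    rw [MonoidHom.noncommCoprod_range, MonoidHom.range_comp, MonoidHom.range_comp,
      Subgroup.range_subtype, Subgroup.range_subtype]
    rfl
  exact ⟨(MonoidHom.ofInjective hφ).trans (MulEquiv.subgroupCongr hrange), fun _ _ => rfl⟩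

lemma glued_mem_gluedProduct {p : ℤˣ × Perm M} {p' : ℤˣ × Perm M'} (hp : uniform p ∈ G)
    (hp' : uniform p' ∈ G') : glued (p, p') ∈ gluedProduct G G' := by
  rw [← glueLeft_mul_glueRight_uniform]
  exact Subgroup.mul_mem_sup (Subgroup.mem_map_of_mem _ hp) (Subgroup.mem_map_of_mem _ hp')

lemma exists_eq_glued_of_mem_gluedProduct [Nonempty M] [Nonempty M']
    (hG : G ≤ (uniform (M := M)).range) (hG' : G' ≤ (uniform (M := M')).range)
    {g : WB (Option (M ⊕ M'))} (hg : g ∈ gluedProduct G G') :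
    ∃ p p', uniform p ∈ G ∧ uniform p' ∈ G' ∧ g = glued (p, p') := by
  obtain ⟨e, he⟩ := isDirectProduct_of_le_range_uniform hG hG'
  obtain ⟨⟨⟨_, ha⟩, ⟨_, hb⟩⟩, h⟩ := e.surjective ⟨g, hg⟩
  obtain ⟨p, rfl⟩ := hG ha
  obtain ⟨p', rfl⟩ := hG' hb
  exact ⟨p, p', ha, hb, by rw [← glueLeft_mul_glueRight_uniform, ← he ⟨_, ha⟩ ⟨_, hb⟩, h]⟩

lemma odd_card_block (hM : Odd (Nat.card M)) (hM' : Odd (Nat.card M')) (k : Fin 3) :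
    Odd (Nat.card {o : Option (M ⊕ M') // block o = k}) := by
  change Odd (Nat.card ↑{o : Option (M ⊕ M') | block o = k})
  fin_cases k
  · have : {o : Option (M ⊕ M') | block o = 0} = Set.range (some ∘ Sum.inl) := by
      ext (_ | _ | _) <;> simp [block]
    rwa [Fin.zero_eta, this,
      Nat.card_range_of_injective ((Option.some_injective _).comp Sum.inl_injective)]
  · have : {o : Option (M ⊕ M') | block o = 1} = Set.range (some ∘ Sum.inr) := by
      ext (_ | _ | _) <;> simp [block]
    rwa [Fin.mk_one, this,
      Nat.card_range_of_injective ((Option.some_injective _).comp Sum.inr_injective)]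
  · have : {o : Option (M ⊕ M') | block o = 2} = {none} := by
      ext (_ | _ | _) <;> simp [block]
    change Odd (Nat.card ↑{o : Option (M ⊕ M') | block o = 2})
    rw [this]
    simp

lemma glued_mem_WD [Fintype M] [Fintype M'] (hM : Odd (Nat.card M)) (hM' : Odd (Nat.card M'))
    (p : (ℤˣ × Perm M) × (ℤˣ × Perm M')) : glued p ∈ WD (Option (M ⊕ M')) := by
  change ∏ o, ![p.1.1, p.2.1, p.1.1 * p.2.1] (block o) = 1
  rw [prod_comp_of_odd_card_fiber Int.units_sq (odd_card_block hM hM'), Fin.prod_univ_three]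
  exact Int.units_mul_self _

lemma isBlockSigned_glued {p : (ℤˣ × Perm M) × (ℤˣ × Perm M')}
    (h : p.1.1 = -1 → (Function.fixedPoints p.1.2).Subsingleton)
    (h' : p.2.1 = -1 → (Function.fixedPoints p.2.2).Subsingleton) :
    IsBlockSigned block (glued p) where
  block_smul := by rintro (_ | _ | _) <;> rfl
  left_eq _ _ hij := congrArg ![p.1.1, p.2.1, p.1.1 * p.2.1] hij
  eq_of_fixed := by
    rintro (_ | i | i) (_ | j | j) hij hs hi hj <;> try cases hij
    · rfl
    · rw [h hs (Sum.inl_injective (Option.some_injective _ hi))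
        (Sum.inl_injective (Option.some_injective _ hj))]
    · rw [h' hs (Sum.inr_injective (Option.some_injective _ hi))
        (Sum.inr_injective (Option.some_injective _ hj))]

/-- A group of signed permutations of constant sign fixing the last index, in which every element
of sign `-1` fixes at most one other index, and every other index is fixed by such an element. -/
structure HasPointReflections (G : Subgroup (WB (Option M))) : Prop where
  le_range : G ≤ (uniform (M := M)).range
  subsingleton_fixedPoints : ∀ τ, uniform (-1, τ) ∈ G → (Function.fixedPoints τ).Subsingleton
  exists_fixed : ∀ i : M, ∃ τ, uniform (-1, τ) ∈ G ∧ τ i = i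

lemma HasPointReflections.exists_glued_fixed [Nonempty M] [Nonempty M']
    (hG : HasPointReflections G) (hG' : HasPointReflections G') (o : Option (M ⊕ M')) :
    ∃ g ∈ gluedProduct G G', g • o = o ∧ g.left o = -1 := by
  rcases o with _ | i | j
  · obtain ⟨τ, hτ, -⟩ := hG.exists_fixed (Classical.arbitrary M)
    exact ⟨_, glued_mem_gluedProduct hτ (p' := 1) (by rw [map_one]; exact G'.one_mem), rfl,
      mul_one (-1)⟩
  · obtain ⟨τ, hτ, hi⟩ := hG.exists_fixed i
    exact ⟨_, glued_mem_gluedProduct hτ (p' := 1) (by rw [map_one]; exact G'.one_mem),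
      congrArg (some ∘ Sum.inl) hi, rfl⟩
  · obtain ⟨τ, hτ, hj⟩ := hG'.exists_fixed j
    exact ⟨_, glued_mem_gluedProduct (p := 1) (by rw [map_one]; exact G.one_mem) hτ,
      congrArg (some ∘ Sum.inr) hj, rfl⟩

end Gluing

/-- Two permutations that become `y ↦ γ y` and `y ↦ y + 1` under a bijection `e` with a commutative
ring, where `γ ^ k - 1` is a unit for odd `k`, and where every element of the ring is reached from
`0` by these two maps. Both `𝔇_{2n+1}` and `𝔉_{p^r}` are generated by such a pair, with signs. -/
structure IsAffinePair {M R : Type*} [CommRing R] (γ : Rˣ) (e : M ≃ R) (τ₁ τ₂ : Perm M) :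
    Prop where
  apply_mul : ∀ i, e (τ₁ i) = γ * e i
  apply_add_one : ∀ i, e (τ₂ i) = e i + 1
  isUnit_zpow_sub_one : ∀ k : ℤ, Odd k → IsUnit (((γ ^ k : Rˣ) : R) - 1)
  mem_of_closed : ∀ A : Set R, 0 ∈ A → (∀ y ∈ A, y + 1 ∈ A) → (∀ y ∈ A, (γ : R) * y ∈ A) →
    ∀ y, y ∈ A

section Affine

lemma exists_fixed_apply {M : Type} {G : Subgroup (WB (Option M))} {u : ℤˣ} {σ : Perm M}
    (hσ : uniform (u, σ) ∈ G) {i : M} (hi : ∃ τ, uniform (-1, τ) ∈ G ∧ τ i = i) :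
    ∃ τ, uniform (-1, τ) ∈ G ∧ τ (σ i) = σ i := by
  obtain ⟨τ, hτ, hi⟩ := hi
  have hconj : ((-1, σ * τ * σ⁻¹) : ℤˣ × Perm M) = (u, σ) * (-1, τ) * (u, σ)⁻¹ :=
    Prod.ext (mul_inv_cancel_comm u (-1)).symm rfl
  refine ⟨σ * τ * σ⁻¹, ?_, by simp [hi]⟩
  rw [hconj, map_mul, map_mul, map_inv]
  exact G.mul_mem (G.mul_mem hσ hτ) (G.inv_mem hσ)

variable {M : Type} {R : Type*} [CommRing R] {γ : Rˣ} {e : M ≃ R} {τ₁ τ₂ : Perm M}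

lemma IsAffinePair.exists_affine (h : IsAffinePair γ e τ₁ τ₂) {g : WB (Option M)}
    (hg : g ∈ Subgroup.closure {allSigns τ₁, noSigns τ₂}) :
    ∃ (k : ℤ) (τ : Perm M), uniform ((-1) ^ k, τ) = g ∧
      ∃ b : R, ∀ i, e (τ i) = ((γ ^ k : Rˣ) : R) * e i + b := by
  induction hg using Subgroup.closure_induction with
  | mem g hg =>
    rcases hg with rfl | rfl
    · exact ⟨1, τ₁, rfl, 0, by simp [h.apply_mul]⟩
    · exact ⟨0, τ₂, rfl, 1, by simp [h.apply_add_one]⟩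
  | one => exact ⟨0, 1, map_one uniform, 0, by simp⟩
  | mul g g' _ _ ih ih' =>
    obtain ⟨k, τ, rfl, b, hτ⟩ := ih
    obtain ⟨k', τ', rfl, b', hτ'⟩ := ih'
    refine ⟨k + k', τ * τ', ?_, ((γ ^ k : Rˣ) : R) * b' + b, fun i => ?_⟩
    · rw [← map_mul, Prod.mk_mul_mk, zpow_add]
    · rw [Perm.mul_apply, hτ, hτ', zpow_add, Units.val_mul]
      ring
  | inv g _ ih =>
    obtain ⟨k, τ, rfl, b, hτ⟩ := ih
    refine ⟨-k, τ⁻¹, ?_, -(((γ ^ (-k) : Rˣ) : R) * b), fun i => ?_⟩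
    · rw [← map_inv, Prod.inv_mk, zpow_neg]
    · have hi := hτ (τ⁻¹ i)
      rw [← Perm.mul_apply, mul_inv_cancel, Perm.one_apply] at hi
      rw [hi, mul_add, ← mul_assoc, ← Units.val_mul, ← zpow_add]
      simp

lemma IsAffinePair.subsingleton_fixedPoints (h : IsAffinePair γ e τ₁ τ₂) {τ : Perm M}
    (hτ : uniform (-1, τ) ∈ Subgroup.closure {allSigns τ₁, noSigns τ₂}) :
    (Function.fixedPoints τ).Subsingleton := by
  obtain ⟨k, τ', hk, b, hb⟩ := h.exists_affine hτ
  obtain ⟨hsign, rfl⟩ := Prod.mk_inj.1 (uniform_injective hk)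
  have hodd : Odd k := by
    by_contra heven
    rw [(Int.not_odd_iff_even.1 heven).neg_one_zpow] at hsign
    exact absurd hsign (by decide)
  intro i hi j hj
  have hbi := hb i
  have hbj := hb j
  rw [hi] at hbi
  rw [hj] at hbj
  refine e.injective ((h.isUnit_zpow_sub_one k hodd).mul_left_cancel ?_)
  linear_combination hbj - hbi

lemma IsAffinePair.exists_fixed (h : IsAffinePair γ e τ₁ τ₂) (i : M) :
    ∃ τ, uniform (-1, τ) ∈ Subgroup.closure {allSigns τ₁, noSigns τ₂} ∧ τ i = i := by
  have hτ₁ : uniform (-1, τ₁) ∈ Subgroup.closure {allSigns τ₁, noSigns τ₂} :=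
    Subgroup.subset_closure (Or.inl rfl)
  have hτ₂ : uniform (1, τ₂) ∈ Subgroup.closure {allSigns τ₁, noSigns τ₂} :=
    Subgroup.subset_closure (Or.inr rfl)
  obtain ⟨y, rfl⟩ := e.symm.surjective i
  refine h.mem_of_closed {y | ∃ τ, uniform (-1, τ) ∈ Subgroup.closure {allSigns τ₁, noSigns τ₂} ∧
    τ (e.symm y) = e.symm y} ⟨τ₁, hτ₁, e.injective ?_⟩ (fun y hy => ?_) (fun y hy => ?_) y
  · simp [h.apply_mul]
  · have hsymm : e.symm (y + 1) = τ₂ (e.symm y) := e.injective (by simp [h.apply_add_one])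
    simpa only [Set.mem_ofPred_eq, hsymm] using exists_fixed_apply hτ₂ hy
  · have hsymm : e.symm (γ * y) = τ₁ (e.symm y) := e.injective (by simp [h.apply_mul])
    simpa only [Set.mem_ofPred_eq, hsymm] using exists_fixed_apply hτ₁ hy

theorem IsAffinePair.hasPointReflections (h : IsAffinePair γ e τ₁ τ₂) :
    HasPointReflections (Subgroup.closure {allSigns τ₁, noSigns τ₂}) where
  le_range _ hg := by
    obtain ⟨k, τ, hkτ, -⟩ := h.exists_affine hg
    exact ⟨_, hkτ⟩
  subsingleton_fixedPoints _ := h.subsingleton_fixedPoints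
  exists_fixed := h.exists_fixed

end Affine

section Dihedral

/-- The indices `1, 2, 4, …, 2n, 2n+1, 2n-1, …, 3`, lowered by one, in the order of the cycle
`dihedralPerm₂ n`. -/
def dihedralCycle (n : ℕ) (k : Fin (2 * n + 1)) : Fin (2 * n + 1) :=
  if h : (k : ℕ) = 0 then k
  else if h' : (k : ℕ) ≤ n then ⟨2 * k - 1, by omega⟩
  else ⟨2 * (2 * n + 1 - k), by omega⟩

lemma val_dihedralCycle (n : ℕ) (k : Fin (2 * n + 1)) : (dihedralCycle n k : ℕ) =
    if (k : ℕ) = 0 then 0 else if (k : ℕ) ≤ n then 2 * (k : ℕ) - 1 else 2 * (2 * n + 1 - k) := by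
  unfold dihedralCycle
  split_ifs <;> simp_all

lemma val_dihedralPerm₁ (n : ℕ) (i : Fin (2 * n + 1)) : (dihedralPerm₁ n i : ℕ) =
    if (i : ℕ) = 0 then 0 else if (i : ℕ) % 2 = 1 then (i : ℕ) + 1 else i - 1 := by
  change Fin.val (if (i : ℕ) = 0 then i
    else if h : (i : ℕ) % 2 = 1 then ⟨i + 1, by omega⟩ else ⟨i - 1, by omega⟩) = _
  split_ifs <;> simp_all

lemma dihedralCycle_injective (n : ℕ) : Function.Injective (dihedralCycle n) := by
  intro k l h
  have hval := congrArg Fin.val h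
  rw [val_dihedralCycle, val_dihedralCycle] at hval
  ext
  split_ifs at hval <;> omega

/-- The labelling of the indices by `ℤ/(2n+1)` along the cycle `dihedralPerm₂ n`. -/
noncomputable def dihedralEquiv (n : ℕ) : ZMod (2 * n + 1) ≃ Fin (2 * n + 1) :=
  (ZMod.finEquiv (2 * n + 1)).symm.toEquiv.trans
    (Equiv.ofBijective _ (Finite.injective_iff_bijective.1 (dihedralCycle_injective n)))

lemma dihedralPerm₂_dihedralCycle (n : ℕ) (k : Fin (2 * n + 1)) :
    dihedralPerm₂ n (dihedralCycle n k) = dihedralCycle n (k + 1) := by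
  change List.formPerm (List.ofFn (dihedralCycle n)) (dihedralCycle n k) = _
  have h := List.formPerm_apply_getElem (List.ofFn (dihedralCycle n))
    (List.nodup_ofFn.2 (dihedralCycle_injective n)) k (by simpa using k.2)
  simp only [List.getElem_ofFn, List.length_ofFn] at h
  refine h.trans (congrArg _ (Fin.ext ?_))
  simp [Fin.val_add]

lemma dihedralPerm₁_dihedralCycle (n : ℕ) (k : Fin (2 * n + 1)) :
    dihedralPerm₁ n (dihedralCycle n k) = dihedralCycle n (-k) := by
  have hneg : ((-k : Fin (2 * n + 1)) : ℕ) = if (k : ℕ) = 0 then 0 else 2 * n + 1 - k := by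
    rw [Fin.val_neg']
    split_ifs with h
    · simp [h]
    · exact Nat.mod_eq_of_lt (by omega)
  have hk := k.2
  ext
  rw [val_dihedralPerm₁, val_dihedralCycle, val_dihedralCycle, hneg]
  split_ifs <;> omega

lemma isAffinePair_dihedral (n : ℕ) :
    IsAffinePair (-1 : (ZMod (2 * n + 1))ˣ) (dihedralEquiv n).symm (dihedralPerm₁ n)
      (dihedralPerm₂ n) where
  apply_mul i := by
    obtain ⟨y, rfl⟩ := (dihedralEquiv n).surjective i
    rw [Equiv.symm_apply_eq, Equiv.symm_apply_apply]
    simpa [dihedralEquiv] using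
      dihedralPerm₁_dihedralCycle n ((ZMod.finEquiv (2 * n + 1)).symm y)
  apply_add_one i := by
    obtain ⟨y, rfl⟩ := (dihedralEquiv n).surjective i
    rw [Equiv.symm_apply_eq, Equiv.symm_apply_apply]
    simpa [dihedralEquiv] using
      dihedralPerm₂_dihedralCycle n ((ZMod.finEquiv (2 * n + 1)).symm y)
  isUnit_zpow_sub_one k hk := by
    have htwo : IsUnit ((2 : ℕ) : ZMod (2 * n + 1)) :=
      (ZMod.isUnit_iff_coprime _ _).2 (by simp)
    have hneg : ((-1 : (ZMod (2 * n + 1))ˣ) : ZMod (2 * n + 1)) - 1 = -((2 : ℕ) : ZMod _) := by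
      push_cast
      ring
    rw [hk.neg_one_zpow, hneg]
    exact htwo.neg
  mem_of_closed A hzero hadd _ y := by
    obtain ⟨m, rfl⟩ := ZMod.natCast_zmod_surjective y
    induction m with
    | zero => simpa using hzero
    | succ m ih => simpa using hadd _ ih

lemma hasPointReflections_dihedral (n : ℕ) : HasPointReflections (dihedral n) :=
  (isAffinePair_dihedral n).hasPointReflections

end Dihedral

section Frobenius

open Polynomial

lemma val_frobeniusPerm₂ (p r : ℕ) [NeZero p] (hr : 0 < r) (i : Fin (p ^ r)) :
    (frobeniusPerm₂ p r hr i : ℕ) = ((i : ℕ) % p + 1) % p + p * (i / p) := by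
  obtain ⟨p, rfl⟩ := Nat.exists_eq_add_one_of_ne_zero (NeZero.ne p)
  simp [frobeniusPerm₂, Equiv.permCongr_apply, Fin.val_add]

lemma val_finFunctionFinEquiv_succ {p r : ℕ} (f : Fin (r + 1) → Fin p) :
    (finFunctionFinEquiv f : ℕ) = f 0 + p * ∑ i : Fin r, (f i.succ : ℕ) * p ^ (i : ℕ) := by
  rw [finFunctionFinEquiv_apply, Fin.sum_univ_succ, Finset.mul_sum]
  simp only [Fin.val_zero, pow_zero, mul_one, Fin.val_succ, pow_succ]
  congr 1
  exact Finset.sum_congr rfl fun i _ => by ring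

lemma frobeniusPerm₂_finFunctionFinEquiv {p r : ℕ} [NeZero p] (hr : 0 < r) {f f' : Fin r → Fin p}
    (h0 : f' ⟨0, hr⟩ = f ⟨0, hr⟩ + 1) (h : ∀ i : Fin r, (i : ℕ) ≠ 0 → f' i = f i) :
    frobeniusPerm₂ p r hr (finFunctionFinEquiv f) = finFunctionFinEquiv f' := by
  obtain ⟨r, rfl⟩ := Nat.exists_eq_add_one_of_ne_zero hr.ne'
  replace h0 : f' 0 = f 0 + 1 := h0
  ext
  rw [val_frobeniusPerm₂, val_finFunctionFinEquiv_succ, val_finFunctionFinEquiv_succ,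
    Nat.add_mul_mod_self_left, Nat.add_mul_div_left _ _ (Nat.pos_of_neZero p),
    Nat.mod_eq_of_lt (f 0).2, Nat.div_eq_of_lt (f 0).2, zero_add, h0, Fin.val_add,
    Fin.coe_ofNat_eq_mod, Nat.add_mod_mod,
    Finset.sum_congr rfl fun i _ => by rw [← h i.succ (by simp)]]

lemma frobeniusPerm₂_lab {p : ℕ} [Fact p.Prime] {h : (ZMod p)[X]} (hm : h.Monic)
    (hr : 0 < h.natDegree) (y : AdjoinRoot h) :
    frobeniusPerm₂ p h.natDegree hr (lab p hm y) = lab p hm (y + 1) := by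
  have hone : AdjoinRoot.modByMonicHom hm 1 = 1 := by
    rw [← map_one (AdjoinRoot.mk h), AdjoinRoot.modByMonicHom_mk, modByMonic_eq_self_iff hm]
    simpa using natDegree_pos_iff_degree_pos.1 hr
  have hcoeff (i : Fin h.natDegree) : (AdjoinRoot.powerBasisAux' hm).equivFun (y + 1) i =
      (AdjoinRoot.powerBasisAux' hm).equivFun y i + if (i : ℕ) = 0 then 1 else 0 := by
    rw [map_add, Pi.add_apply]
    congr 1
    change (AdjoinRoot.modByMonicHom hm 1).coeff i = _
    rw [hone, coeff_one]
  refine frobeniusPerm₂_finFunctionFinEquiv hr ?_ fun i hi => ?_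
  · change (ZMod.finEquiv p).symm _ = (ZMod.finEquiv p).symm _ + 1
    rw [← map_one (ZMod.finEquiv p).symm, ← map_add]
    exact congrArg _ ((hcoeff _).trans (by simp))
  · change (ZMod.finEquiv p).symm _ = (ZMod.finEquiv p).symm _
    exact congrArg _ ((hcoeff _).trans (by simp [hi]))

lemma even_of_zpow_eq_one {G : Type*} [Group G] {g : G} (hG : Even (Nat.card G))
    (hg : ∀ u : G, u ∈ Subgroup.zpowers g) {k : ℤ} (hk : g ^ k = 1) : Even k := by
  have hdvd : (Nat.card G : ℤ) ∣ k :=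
    orderOf_eq_card_of_forall_mem_zpowers hg ▸ orderOf_dvd_iff_zpow_eq_one.2 hk
  exact even_iff_two_dvd.2 ((Int.natCast_dvd_natCast.2 hG.two_dvd).trans hdvd)

lemma isAffinePair_frobenius {p : ℕ} [Fact p.Prime] {h : (ZMod p)[X]} (hm : h.Monic)
    (hr : 0 < h.natDegree) {Γ : (AdjoinRoot h)ˣ} (hp : p ≠ 2) (hirr : Irreducible h)
    (hΓ : ∀ u : (AdjoinRoot h)ˣ, u ∈ Subgroup.zpowers Γ) :
    IsAffinePair Γ (lab p hm).symm (frobeniusPerm₁ p hm Γ)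
      (frobeniusPerm₂ p h.natDegree hr) := by
  have : Fact (Irreducible h) := ⟨hirr⟩
  have : Finite (AdjoinRoot h) := Finite.of_equiv _ (lab p hm).symm
  have hcard : Even (Nat.card (AdjoinRoot h)ˣ) := by
    rw [Nat.card_units, Nat.card_congr (lab p hm), Nat.card_fin]
    exact Nat.Odd.sub_odd ((Fact.out : p.Prime).odd_of_ne_two hp).pow odd_one
  refine ⟨fun i => ?_, fun i => ?_, fun k hk => ?_, fun A hzero hadd hmul y => ?_⟩
  · simp [frobeniusPerm₁, Equiv.permCongr_apply]
  · rw [Equiv.symm_apply_eq, ← frobeniusPerm₂_lab hm hr, Equiv.apply_symm_apply]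
  · rw [isUnit_iff_ne_zero, sub_ne_zero]
    exact fun h1 => Int.not_even_iff_odd.2 hk (even_of_zpow_eq_one hcard hΓ (Units.ext h1))
  · rcases eq_or_ne y 0 with rfl | hy
    · exact hzero
    obtain ⟨m, hpow⟩ := mem_powers_iff_mem_zpowers.2 (hΓ (Units.mk0 y hy))
    obtain rfl : (Γ : AdjoinRoot h) ^ m = y := congrArg Units.val hpow
    clear hpow hy
    induction m with
    | zero => simpa using hadd 0 hzero
    | succ m ih => rw [pow_succ']; exact hmul _ ih

lemma hasPointReflections_frobenius {p : ℕ} [Fact p.Prime] {h : (ZMod p)[X]} (hm : h.Monic)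
    (hr : 0 < h.natDegree) {Γ : (AdjoinRoot h)ˣ} (hp : p ≠ 2) (hirr : Irreducible h)
    (hΓ : ∀ u : (AdjoinRoot h)ˣ, u ∈ Subgroup.zpowers Γ) :
    HasPointReflections (frobenius p hm hr Γ) :=
  (isAffinePair_frobenius hm hr hp hirr hΓ).hasPointReflections

end Frobenius

theorem mainTheorem6_general {M M' : Type} [Fintype M] [Fintype M'] (hM : Odd (Nat.card M))
    (hM' : Odd (Nat.card M')) {G : Subgroup (WB (Option M))} {G' : Subgroup (WB (Option M'))}
    (hG : HasPointReflections G) (hG' : HasPointReflections G') :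
    IsDirectProduct G G' ∧ gluedProduct G G' ≤ WD _ ∧
      SatisfiesH1 ((gluedProduct G G').subgroupOf (WD _)) ∧
      IsRelativelyMinimal ((gluedProduct G G').subgroupOf (WD _)) := by
  have : Nonempty M := (Nat.card_pos_iff.1 hM.pos).1
  have : Nonempty M' := (Nat.card_pos_iff.1 hM'.pos).1
  have hWD : gluedProduct G G' ≤ WD _ := fun g hg => by
    obtain ⟨p, p', -, -, rfl⟩ := exists_eq_glued_of_mem_gluedProduct hG.le_range hG'.le_range hg
    exact glued_mem_WD hM hM' _
  refine ⟨isDirectProduct_of_le_range_uniform hG.le_range hG'.le_range, hWD,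
    satisfiesH1_of_isBlockSigned (odd_card_block hM hM') fun g hg => ?_,
    isRelativelyMinimal_of_exists_fixed fun o => ?_⟩
  · obtain ⟨⟨u, τ⟩, ⟨u', τ'⟩, hp, hp', h⟩ :=
      exists_eq_glued_of_mem_gluedProduct hG.le_range hG'.le_range hg
    rw [Subgroup.subtype_apply] at h
    rw [h]
    exact isBlockSigned_glued (by rintro rfl; exact hG.subsingleton_fixedPoints τ hp)
      (by rintro rfl; exact hG'.subsingleton_fixedPoints τ' hp')
  · obtain ⟨g, hg, ho⟩ := hG.exists_glued_fixed hG' o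
    exact ⟨⟨g, hWD hg⟩, hg, ho⟩

end ConicBundle

open ConicBundle Polynomial in
theorem mainTheorem6 :
    (∀ n₁ n₂ : ℕ, 0 < n₁ → 0 < n₂ →
      IsDirectProduct (dihedral n₁) (dihedral n₂) ∧
      gluedProduct (dihedral n₁) (dihedral n₂) ≤ WD _ ∧
      SatisfiesH1 ((gluedProduct (dihedral n₁) (dihedral n₂)).subgroupOf (WD _)) ∧
      IsRelativelyMinimal ((gluedProduct (dihedral n₁) (dihedral n₂)).subgroupOf (WD _))) ∧
    (∀ (n : ℕ) (p : ℕ) [Fact p.Prime] (h : (ZMod p)[X]) (hm : h.Monic) (hr : 0 < h.natDegree)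
      (Γ : (AdjoinRoot h)ˣ), 0 < n → p ≠ 2 → Irreducible h →
      (∀ u : (AdjoinRoot h)ˣ, u ∈ Subgroup.zpowers Γ) →
      IsDirectProduct (dihedral n) (frobenius p hm hr Γ) ∧
      gluedProduct (dihedral n) (frobenius p hm hr Γ) ≤ WD _ ∧
      SatisfiesH1 ((gluedProduct (dihedral n) (frobenius p hm hr Γ)).subgroupOf (WD _)) ∧
      IsRelativelyMinimal
        ((gluedProduct (dihedral n) (frobenius p hm hr Γ)).subgroupOf (WD _))) := by
  have hodd (n : ℕ) : Odd (Nat.card (Fin (2 * n + 1))) := by simp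
  refine ⟨fun n₁ n₂ _ _ => mainTheorem6_general (hodd n₁) (hodd n₂)
    (hasPointReflections_dihedral n₁) (hasPointReflections_dihedral n₂),
    fun n p _ h hm hr Γ _ hp hirr hΓ => mainTheorem6_general (hodd n) ?_
      (hasPointReflections_dihedral n) (hasPointReflections_frobenius hm hr hp hirr hΓ)⟩
  rw [Nat.card_fin]
  exact ((Fact.out : p.Prime).odd_of_ne_two hp).pow
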